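/- **Central Limit Theorem for the multi-group Curie–Weiss model at high temperature.** Let $M\ge 1$ and let $J=(J_{\lambda\mu})$ be a real symmetric $M\times M$ matrix. For group sizes $N_1,\dots,N_M$ with $N=N_1+\dots+N_M$, let the spins $(X_{\lambda i})_{1\le\lambda\le M,\,1\le i\le N_\lambda}$ with values in $\{-1,1\}$ have the joint law $$\mathbb P(X=x)=Z^{-1}\exp\Big(\frac1{2N}\sum_{\lambda,\mu=1}^M J_{\lambda\mu}\sum_{i=1}^{N_\lambda}\sum_{j=1}^{N_\mu}x_{\lambda i}x_{\mu j}\Big),\qquad x\in\{-1,1\}^N,$$ where $Z$ is the normalising constant, and let $S_\lambda=\sum_{i=1}^{N_\lambda}X_{\lambda i}$. Let the group sizes vary along a sequence such that $N_\lambda\to\infty$ and $N_\lambda/N\to\alpha_\lambda$ for every $\lambda$ (the value $\alpha_\lambda=0$ is allowed). Put $\boldsymbol\alpha=\operatorname{diag}(\alpha_1,\dots,\alpha_M)$ and $\sqrt{\boldsymbol\alpha}=\operatorname{diag}(\sqrt{\alpha_1},\dots,\sqrt{\alpha_M})$. Assume that one of the following holds. 1. (Homogeneous case) All entries of $J$ are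 equal to a constant $\beta$ with $0\le\beta<1$. In this case let $\Sigma$ be the $M\times M$ matrix all of whose entries are $\frac{\beta}{1-\beta}$. 2. (Heterogeneous case) $J$ is positive definite and $H:=J^{-1}-\boldsymbol\alpha$ is positive definite. In this case let $\Sigma=H^{-1}$. Then $C:=I+\sqrt{\boldsymbol\alpha}\,\Sigma\,\sqrt{\boldsymbol\alpha}$ is positive semidefinite and $$\Big(\frac{S_1}{\sqrt{N_1}},\dots,\frac{S_M}{\sqrt{N_M}}\Big)\Longrightarrow\mathcal N(0,C)$$ weakly as $N\to\infty$. -/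

import Mathlib

open MeasureTheory ProbabilityTheory Filter Topology

namespace CurieWeiss

/-- Spin configurations of `M` groups of sizes `n 0, …, n (M - 1)`: the spin `x l i` of the
`i`-th member of group `l` takes a value in `ℤˣ = {1, -1}`. -/
abbrev Config {M : ℕ} (n : Fin M → ℕ) : Type := (l : Fin M) → Fin (n l) → ℤˣ

/-- The value of a spin as a real number, `1` or `-1`. -/
def spin (s : ℤˣ) : ℝ := ((s : ℤ) : ℝ)

/-- The total number of spins. -/
def total {M : ℕ} (n : Fin M → ℕ) : ℕ := ∑ l, n l

/-- The Hamiltonian `-(1 / (2 N)) ∑_{l, m} J_{l m} ∑_i ∑_j x_{l i} x_{m j}`. -/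
noncomputable def hamiltonian {M : ℕ} (J : Matrix (Fin M) (Fin M) ℝ) (n : Fin M → ℕ)
    (x : Config n) : ℝ :=
  -(1 / (2 * (total n : ℝ))) *
    ∑ l, ∑ m, J l m * ∑ i : Fin (n l), ∑ j : Fin (n m), spin (x l i) * spin (x m j)

/-- The normalising constant `Z`. -/
noncomputable def partitionFunction {M : ℕ} (J : Matrix (Fin M) (Fin M) ℝ) (n : Fin M → ℕ) : ℝ :=
  ∑ x : Config n, Real.exp (-hamiltonian J n x)

/-- The canonical ensemble: the configuration `x` has probability `Z⁻¹ exp (-ℍ x)`. -/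
noncomputable def canonicalEnsemble {M : ℕ} (J : Matrix (Fin M) (Fin M) ℝ) (n : Fin M → ℕ) :
    Measure (Config n) :=
  ∑ x : Config n,
    ENNReal.ofReal ((partitionFunction J n)⁻¹ * Real.exp (-hamiltonian J n x)) • Measure.dirac x

theorem partitionFunction_pos {M : ℕ} (J : Matrix (Fin M) (Fin M) ℝ) (n : Fin M → ℕ) :
    0 < partitionFunction J n :=
  Finset.sum_pos (fun _ _ => Real.exp_pos _) Finset.univ_nonempty

instance {M : ℕ} (J : Matrix (Fin M) (Fin M) ℝ) (n : Fin M → ℕ) :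
    IsProbabilityMeasure (canonicalEnsemble J n) where
  measure_univ := by
    have hZ := partitionFunction_pos J n
    simp only [canonicalEnsemble, Measure.coe_finsetSum, Finset.sum_apply, Measure.smul_apply,
      measure_univ, smul_eq_mul, mul_one]
    rw [← ENNReal.ofReal_sum_of_nonneg (fun x _ => by positivity), ← Finset.mul_sum]
    change ENNReal.ofReal ((partitionFunction J n)⁻¹ * partitionFunction J n) = 1
    rw [inv_mul_cancel₀ hZ.ne', ENNReal.ofReal_one]

/-- The magnetisation `S_l = ∑_i X_{l i}` of group `l`. -/
noncomputable def magnetisation {M : ℕ} (n : Fin M → ℕ) (x : Config n) (l : Fin M) : ℝ :=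
  ∑ i : Fin (n l), spin (x l i)

/-- The random vector `(S_1 / √N_1, …, S_M / √N_M)`. -/
noncomputable def normalisedMagnetisation {M : ℕ} (n : Fin M → ℕ) (x : Config n) :
    EuclideanSpace ℝ (Fin M) :=
  WithLp.toLp 2 fun l => magnetisation n x l / √(n l : ℝ)

/-- The matrix all of whose entries equal `c`. -/
def constMatrix (M : ℕ) (c : ℝ) : Matrix (Fin M) (Fin M) ℝ := Matrix.of fun _ _ => c

/-- The matrix `H = J⁻¹ - diag α`. -/
noncomputable def hessian {M : ℕ} (J : Matrix (Fin M) (Fin M) ℝ) (α : Fin M → ℝ) :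
    Matrix (Fin M) (Fin M) ℝ :=
  J⁻¹ - Matrix.diagonal α

/-- The matrix `C = I + √α Σ √α`, where `√α = diag (√α_1, …, √α_M)`. -/
noncomputable def limitCovariance {M : ℕ} (α : Fin M → ℝ) (S : Matrix (Fin M) (Fin M) ℝ) :
    Matrix (Fin M) (Fin M) ℝ :=
  1 + Matrix.diagonal (fun l => √(α l)) * S * Matrix.diagonal (fun l => √(α l))

/-- Along the group sizes `n 0, n 1, …`, the vector `(S_1 / √N_1, …, S_M / √N_M)` under the
canonical ensemble with coupling matrix `J` converges in distribution to `𝒩(0, C)`. The matrix `C`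
is required to be positive semidefinite, so that `multivariateGaussian 0 C` is indeed `𝒩(0, C)`. -/
def ConvergesToGaussian {M : ℕ} (J : Matrix (Fin M) (Fin M) ℝ) (n : ℕ → Fin M → ℕ)
    (C : Matrix (Fin M) (Fin M) ℝ) : Prop :=
  C.PosSemidef ∧
    TendstoInDistribution (fun k => normalisedMagnetisation (n k)) atTop
      (id : EuclideanSpace ℝ (Fin M) → EuclideanSpace ℝ (Fin M))
      (fun k => canonicalEnsemble J (n k)) (multivariateGaussian 0 C)

end CurieWeiss

namespace CurieWeiss

section

open Matrix

/-! ### Analytic tools: powers of cosh, Gaussian integrals, positive definite forms. -/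

section

/-! Factor `J = Lᵀ * L`. The Hubbard–Stratonovich identity writes the weight `exp (|L S|² / (2N))`
as a Gaussian average of `exp (g ⬝ L S / √N)` over an auxiliary field `g`; for fixed `g` the spins
decouple. The characteristic function is thus a ratio of integrals of `exp (-|g|²/2) ∏ cosh (w_l) ^
N_l`, with `w_l = (Lᵀ g)_l / √N + i t_l / √N_l` (`charNumerator_eq_integral`).

Since `√N_l w_l` tends to `√α_l (Lᵀ g)_l + i t_l`, `tendsto_cosh_pow` gives the pointwise limit, and
positive definiteness of `K = 1 - L diag(α) Lᵀ` gives a dominating Gaussian. The limit is an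
explicit Gaussian integral with precision matrix `K`, so the ratio tends to `exp (-tᵀ C t / 2)` with
`Σ = Lᵀ K⁻¹ L`, and Lévy's continuity theorem concludes.

Allowing `L` to be rectangular covers both cases: a single row of `√β` when `J` is constant, a
square invertible `L` when `J` is positive definite. -/

theorem exists_sinh_eq_mul : ∃ φ : ℂ → ℂ, ContinuousAt φ 0 ∧ φ 0 = 1 ∧
    ∀ w, Complex.sinh w = w * φ w := by
  refine ⟨dslope Complex.sinh 0, ?_, ?_, fun w => ?_⟩
  · rw [continuousAt_dslope_same]; exact Complex.differentiable_sinh _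
  · simp [dslope_same]
  · have := sub_smul_dslope Complex.sinh 0 w
    simpa using this.symm

theorem exists_log_one_add_eq_mul : ∃ ψ : ℂ → ℂ, ContinuousAt ψ 0 ∧ ψ 0 = 1 ∧
    ∀ h, Complex.log (1 + h) = h * ψ h := by
  have hd : HasDerivAt (fun h : ℂ => Complex.log (1 + h)) 1 0 := by
    have := ((hasDerivAt_id (0 : ℂ)).const_add 1).clog (by simp)
    simpa using this
  refine ⟨dslope (fun h : ℂ => Complex.log (1 + h)) 0, ?_, ?_, fun w => ?_⟩
  · rw [continuousAt_dslope_same]; exact hd.differentiableAt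
  · rw [dslope_same, hd.deriv]
  · have := sub_smul_dslope (fun h : ℂ => Complex.log (1 + h)) 0 w
    simpa using this.symm

/-- Since `cosh w = 1 + 2 sinh² (w/2)`, the exponent `N log cosh w` equals `(√N w)² / 2` times
factors `φ²` and `ψ` that tend to 1. Writing these as continuous divided differences avoids a
separate case `w = 0`. -/
theorem tendsto_cosh_pow {N : ℕ → ℕ} {w : ℕ → ℂ} {z : ℂ} (hN : Tendsto N atTop atTop)
    (hw : Tendsto (fun k => ((√(N k : ℝ) : ℝ) : ℂ) * w k) atTop (𝓝 z)) :
    Tendsto (fun k => Complex.cosh (w k) ^ N k) atTop (𝓝 (Complex.exp (z ^ 2 / 2))) := by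
  obtain ⟨φ, hφ, hφ0, hsinh⟩ := exists_sinh_eq_mul
  obtain ⟨ψ, hψ, hψ0, hlog⟩ := exists_log_one_add_eq_mul
  have hsqrt : Tendsto (fun k => √(N k : ℝ)) atTop atTop :=
    Real.tendsto_sqrt_atTop.comp (tendsto_natCast_atTop_atTop.comp hN)
  have hw0 : Tendsto w atTop (𝓝 0) := by
    have h1 : Tendsto (fun k => (((√(N k : ℝ))⁻¹ : ℝ) : ℂ)) atTop (𝓝 ((0 : ℝ) : ℂ)) :=
      (Complex.continuous_ofReal.tendsto 0).comp hsqrt.inv_tendsto_atTop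
    have h2 := h1.mul hw
    rw [Complex.ofReal_zero, zero_mul] at h2
    refine h2.congr' ?_
    filter_upwards [hsqrt.eventually_gt_atTop 0] with k hk
    rw [← mul_assoc, ← Complex.ofReal_mul, inv_mul_cancel₀ hk.ne', Complex.ofReal_one, one_mul]
  have hhalf : Tendsto (fun k => w k / 2) atTop (𝓝 0) := by simpa using hw0.div_const 2
  have hh : Tendsto (fun k => 2 * Complex.sinh (w k / 2) ^ 2) atTop (𝓝 0) := by
    have := (((Complex.continuous_sinh.tendsto 0).comp hhalf).pow 2).const_mul 2
    simpa using this
  have hcosh : ∀ k, Complex.cosh (w k) = 1 + 2 * Complex.sinh (w k / 2) ^ 2 := fun k => by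
    have h1 := Complex.cosh_two_mul (w k / 2)
    have h2 := Complex.cosh_sq (w k / 2)
    rw [mul_div_cancel₀ _ two_ne_zero] at h1
    rw [h1, h2]; ring
  have hφ' : Tendsto (fun k => φ (w k / 2)) atTop (𝓝 1) := by
    rw [← hφ0]; exact hφ.tendsto.comp hhalf
  have hψ' : Tendsto (fun k => ψ (2 * Complex.sinh (w k / 2) ^ 2)) atTop (𝓝 1) := by
    rw [← hψ0]; exact hψ.tendsto.comp hh
  have hmain : Tendsto (fun k => (N k : ℂ) * Complex.log (1 + 2 * Complex.sinh (w k / 2) ^ 2))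
      atTop (𝓝 (z ^ 2 / 2)) := by
    have := (((hw.pow 2).div_const 2).mul (hφ'.pow 2)).mul hψ'
    rw [one_pow, mul_one, mul_one] at this
    refine this.congr fun k => ?_
    have hs : ((√(N k : ℝ) : ℝ) : ℂ) ^ 2 = N k := by
      rw [← Complex.ofReal_pow, Real.sq_sqrt (Nat.cast_nonneg _), Complex.ofReal_natCast]
    rw [hlog, mul_pow, hs, ← mul_assoc (N k : ℂ)]
    congr 1
    rw [hsinh]; ring
  refine ((Complex.continuous_exp.tendsto _).comp hmain).congr' ?_
  -- `exp (log u) = u` needs only `u ≠ 0`, so no branch question arises.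
  have hne : ∀ᶠ k in atTop, (1 : ℂ) + 2 * Complex.sinh (w k / 2) ^ 2 ≠ 0 := by
    have h1 : Tendsto (fun k => (1 : ℂ) + 2 * Complex.sinh (w k / 2) ^ 2) atTop (𝓝 1) := by
      simpa using hh.const_add 1
    exact h1.eventually_ne one_ne_zero
  filter_upwards [hne] with k hk
  rw [Function.comp_apply, Complex.exp_nat_mul, Complex.exp_log hk, hcosh]

theorem norm_cosh_le_exp (w : ℂ) : ‖Complex.cosh w‖ ≤ Real.exp (w.re ^ 2 / 2) := by
  refine le_trans ?_ (Real.cosh_le_exp_half_sq w.re)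
  rw [Complex.cosh, Real.cosh_eq, norm_div, Complex.norm_ofNat]
  gcongr
  refine (norm_add_le _ _).trans ?_
  simp [Complex.norm_exp]


variable {κ : Type*} [Fintype κ] [DecidableEq κ]

theorem exists_transpose_mul_self {K : Matrix κ κ ℝ} (hK : K.PosSemidef) :
    ∃ R : Matrix κ κ ℝ, K = Rᵀ * R := by
  open scoped MatrixOrder ComplexOrder Matrix.Norms.L2Operator in
  obtain ⟨R, hR⟩ := CStarAlgebra.nonneg_iff_eq_star_mul_self.mp hK.nonneg
  exact ⟨R, by rw [hR, star_eq_conjTranspose, conjTranspose_eq_transpose_of_trivial]⟩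

/-- With `K = Rᵀ * R`, the substitution `v = R g` reduces to the standard Gaussian. The value of `c`
is left open because it cancels in the ratio. -/
theorem exists_integral_cexp_neg_quadratic {K : Matrix κ κ ℝ} (hK : K.PosDef) :
    ∃ c : ℂ, c ≠ 0 ∧ ∀ s : κ → ℝ,
      ∫ g : κ → ℝ, Complex.exp (-((g ⬝ᵥ K *ᵥ g : ℝ) : ℂ) / 2 + ((s ⬝ᵥ g : ℝ) : ℂ) * Complex.I) =
        c * Complex.exp (-((s ⬝ᵥ K⁻¹ *ᵥ s : ℝ) : ℂ) / 2) := by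
  obtain ⟨R, hR⟩ := exists_transpose_mul_self hK.posSemidef
  have hdet : R.det ≠ 0 := by
    have h := hK.det_pos
    rw [hR, det_mul, det_transpose] at h
    exact fun h0 => by simp [h0] at h
  have hunit : IsUnit R.det := hdet.isUnit
  refine ⟨|(R.det)⁻¹| • ((Real.pi / (1 / 2 : ℂ)) ^ (Fintype.card κ / 2 : ℂ)), ?_, fun s => ?_⟩
  · refine smul_ne_zero (abs_ne_zero.2 (inv_ne_zero hdet)) ?_
    rw [Complex.cpow_def_of_ne_zero (by simp [Real.pi_ne_zero])]
    exact Complex.exp_ne_zero _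
  · set w : κ → ℝ := (R⁻¹)ᵀ *ᵥ s with hw
    let f : (κ → ℝ) → ℂ := fun v =>
      Complex.exp (-(1 / 2 : ℂ) * ∑ i, (v i : ℂ) ^ 2 + ∑ i, ((w i : ℂ) * Complex.I) * v i)
    have hf : Continuous f := by fun_prop
    have h1 : ∫ v, f v ∂(Measure.map (toLin' R) volume) = ∫ g, f (toLin' R g) := by
      rw [integral_map (LinearMap.continuous_of_finiteDimensional _).aemeasurable
        hf.aestronglyMeasurable]
    rw [Real.map_matrix_volume_pi_eq_smul_volume_pi hdet, integral_smul_measure,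
      GaussianFourier.integral_cexp_neg_mul_sum_add (by norm_num)] at h1
    have h2 : ∀ g : κ → ℝ, f (toLin' R g) =
        Complex.exp (-((g ⬝ᵥ K *ᵥ g : ℝ) : ℂ) / 2 + ((s ⬝ᵥ g : ℝ) : ℂ) * Complex.I) := fun g => by
      have e1 : g ⬝ᵥ K *ᵥ g = ∑ i, (R *ᵥ g) i ^ 2 := by
        rw [hR, ← mulVec_mulVec, dotProduct_mulVec, vecMul_transpose]
        simp [dotProduct, sq]
      have e2 : s ⬝ᵥ g = ∑ i, w i * (R *ᵥ g) i := by
        change _ = w ⬝ᵥ (R *ᵥ g)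
        rw [hw, mulVec_transpose, ← dotProduct_mulVec, mulVec_mulVec, nonsing_inv_mul _ hunit,
          one_mulVec]
      simp only [f, toLin'_apply]
      rw [e1, e2]
      congr 1
      push_cast
      rw [Finset.sum_mul]
      congr 1
      · ring
      · exact Finset.sum_congr rfl fun i _ => by ring
    have e3 : s ⬝ᵥ K⁻¹ *ᵥ s = ∑ i, w i ^ 2 := by
      rw [hR, Matrix.mul_inv_rev, ← mulVec_mulVec, dotProduct_mulVec, ← transpose_nonsing_inv, ← hw,
        ← mulVec_transpose, ← hw]
      simp [dotProduct, sq]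
    simp_rw [← h2]
    rw [← h1, e3, ENNReal.toReal_ofReal (abs_nonneg _), smul_mul_assoc]
    congr 3
    push_cast
    simp_rw [mul_pow, Complex.I_sq]
    rw [← Finset.sum_mul]
    ring

theorem exists_pos_mul_dotProduct_le {K : Matrix κ κ ℝ} (hK : K.PosDef) :
    ∃ ε > 0, ∀ g : κ → ℝ, ε * (g ⬝ᵥ g) ≤ g ⬝ᵥ K *ᵥ g := by
  obtain ⟨R, hR⟩ := exists_transpose_mul_self hK.posSemidef
  have hunit : IsUnit R.det := by
    have h := hK.det_pos
    rw [hR, det_mul, det_transpose] at h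
    exact isUnit_iff_ne_zero.2 fun h0 => by simp [h0] at h
  -- The squared Frobenius norm of `R⁻¹` bounds `|g|²` by `c |R g|²`; using `c + 1` below keeps the
  -- constant invertible even when `κ` is empty.
  set c : ℝ := ∑ i, ∑ j, R⁻¹ i j ^ 2 with hc
  have hc0 : 0 ≤ c := Finset.sum_nonneg fun i _ => Finset.sum_nonneg fun j _ => sq_nonneg _
  refine ⟨(c + 1)⁻¹, by positivity, fun g => ?_⟩
  have e1 : g ⬝ᵥ K *ᵥ g = ∑ i, (R *ᵥ g) i ^ 2 := by
    rw [hR, ← mulVec_mulVec, dotProduct_mulVec, vecMul_transpose]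
    simp [dotProduct, sq]
  have e2 : g ⬝ᵥ g ≤ c * ∑ i, (R *ᵥ g) i ^ 2 := by
    have h : g = R⁻¹ *ᵥ (R *ᵥ g) := by
      rw [mulVec_mulVec, nonsing_inv_mul _ hunit, one_mulVec]
    rw [hc, Finset.sum_mul, dotProduct]
    refine Finset.sum_le_sum fun i _ => ?_
    have hi : g i = ∑ j, R⁻¹ i j * (R *ᵥ g) j := congrFun h i
    rw [← sq, hi]
    exact Finset.sum_mul_sq_le_sq_mul_sq _ _ _
  have e3 : 0 ≤ ∑ i, (R *ᵥ g) i ^ 2 := Finset.sum_nonneg fun i _ => sq_nonneg _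
  rw [e1, inv_mul_le_iff₀ (by positivity)]
  linarith

theorem dotProduct_one_sub_mul_diagonal_mul_transpose {ι : Type*} [Fintype ι] [DecidableEq ι]
    (L : Matrix κ ι ℝ) (a : ι → ℝ) (g : κ → ℝ) :
    g ⬝ᵥ (1 - L * diagonal a * Lᵀ) *ᵥ g = g ⬝ᵥ g - ∑ l, a l * (Lᵀ *ᵥ g) l ^ 2 := by
  rw [sub_mulVec, dotProduct_sub, one_mulVec, ← mulVec_mulVec, ← mulVec_mulVec, dotProduct_mulVec,
    ← mulVec_transpose]
  congr 1
  simp only [dotProduct, mulVec_diagonal]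
  exact Finset.sum_congr rfl fun l _ => by ring

/-- Coercivity is an open condition: the perturbation `a k - α` eventually costs at most half of the
constant for `α`, uniformly in `g`. -/
theorem exists_eventually_quadratic_le {ι : Type*} [Fintype ι] [DecidableEq ι]
    (L : Matrix κ ι ℝ) {a : ℕ → ι → ℝ} {α : ι → ℝ}
    (ha : ∀ l, Tendsto (fun k => a k l) atTop (𝓝 (α l)))
    (hK : (1 - L * diagonal α * Lᵀ).PosDef) :
    ∃ ε > 0, ∀ᶠ k in atTop, ∀ g : κ → ℝ,
      ε * (g ⬝ᵥ g) ≤ g ⬝ᵥ g - ∑ l, a k l * (Lᵀ *ᵥ g) l ^ 2 := by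
  obtain ⟨ε, hε, hle⟩ := exists_pos_mul_dotProduct_le hK
  refine ⟨ε / 2, half_pos hε, ?_⟩
  have hlim : Tendsto (fun k => ∑ l, |a k l - α l| * ∑ i, L i l ^ 2) atTop (𝓝 0) := by
    have h : ∀ l, Tendsto (fun k => |a k l - α l| * ∑ i, L i l ^ 2) atTop (𝓝 0) := fun l => by
      have := ((ha l).sub_const (α l)).abs.mul_const (∑ i, L i l ^ 2)
      simpa using this
    simpa using tendsto_finsetSum Finset.univ fun l _ => h l
  filter_upwards [hlim.eventually_le_const (half_pos hε)] with k hk g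
  have hg : 0 ≤ g ⬝ᵥ g := Finset.sum_nonneg fun i _ => mul_self_nonneg _
  have h1 := hle g
  rw [dotProduct_one_sub_mul_diagonal_mul_transpose] at h1
  have h2 : ∑ l, a k l * (Lᵀ *ᵥ g) l ^ 2 - ∑ l, α l * (Lᵀ *ᵥ g) l ^ 2 ≤
      (∑ l, |a k l - α l| * ∑ i, L i l ^ 2) * (g ⬝ᵥ g) := by
    rw [← Finset.sum_sub_distrib, Finset.sum_mul]
    refine Finset.sum_le_sum fun l _ => ?_
    rw [← sub_mul, mul_assoc]
    have h3 : (Lᵀ *ᵥ g) l ^ 2 ≤ (∑ i, L i l ^ 2) * (g ⬝ᵥ g) := by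
      have := Finset.sum_mul_sq_le_sq_mul_sq Finset.univ (fun i => L i l) g
      simpa [mulVec, dotProduct, sq] using this
    exact mul_le_mul (le_abs_self _) h3 (sq_nonneg _) (abs_nonneg _)
  have h4 := mul_le_mul_of_nonneg_right hk hg
  linarith

end

/-! ### Hubbard–Stratonovich representation and passage to the limit under the integral. -/

section

instance : DiscreteMeasurableSpace ℤˣ where
  forall_measurableSet s := by
    refine ⟨Units.val '' s, MeasurableSet.of_discrete, ?_⟩
    exact Set.preimage_image_eq s Units.val_injective

variable {M : ℕ} {κ : Type*} [Fintype κ]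

theorem integral_canonicalEnsemble (J : Matrix (Fin M) (Fin M) ℝ) (n : Fin M → ℕ)
    (f : Config n → ℂ) :
    ∫ x, f x ∂(canonicalEnsemble J n) =
      (∑ x, Complex.exp ((-hamiltonian J n x : ℝ) : ℂ) * f x) / (partitionFunction J n : ℂ) := by
  have hfin : ∀ x : Config n, IsFiniteMeasure (ENNReal.ofReal ((partitionFunction J n)⁻¹ *
      Real.exp (-hamiltonian J n x)) • Measure.dirac x) := fun x =>
    Measure.smul_finite _ ENNReal.ofReal_ne_top
  rw [canonicalEnsemble, integral_finsetSum_measure fun x _ => Integrable.of_finite,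
    Finset.sum_div]
  refine Finset.sum_congr rfl fun x _ => ?_
  have hZ := partitionFunction_pos J n
  rw [integral_smul_measure, integral_dirac, ENNReal.toReal_ofReal (by positivity),
    Complex.real_smul]
  push_cast
  ring

/-- The numerator of the characteristic function of the normalised magnetisation. -/
noncomputable def charNumerator (J : Matrix (Fin M) (Fin M) ℝ) (n : Fin M → ℕ)
    (t : Fin M → ℝ) : ℂ :=
  ∑ x : Config n, Complex.exp (((-hamiltonian J n x : ℝ) : ℂ) +
    ((∑ l, t l * (magnetisation n x l / √(n l : ℝ)) : ℝ) : ℂ) * Complex.I)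

theorem charFun_normalisedMagnetisation (J : Matrix (Fin M) (Fin M) ℝ) (n : Fin M → ℕ)
    (t : EuclideanSpace ℝ (Fin M)) :
    charFun ((canonicalEnsemble J n).map (normalisedMagnetisation n)) t =
      charNumerator J n t / charNumerator J n 0 := by
  rw [charFun_apply, integral_map (measurable_of_finite _).aemeasurable (by fun_prop),
    integral_canonicalEnsemble]
  congr 1
  · refine Finset.sum_congr rfl fun x _ => ?_
    rw [← Complex.exp_add]
    simp [normalisedMagnetisation, PiLp.inner_apply]
  · simp [charNumerator, partitionFunction]

theorem neg_hamiltonian_transpose_mul_self (L : Matrix κ (Fin M) ℝ) (n : Fin M → ℕ)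
    (x : Config n) :
    -hamiltonian (Lᵀ * L) n x =
      (∑ i, ((L *ᵥ magnetisation n x) i / √(total n : ℝ)) ^ 2) / 2 := by
  have h : ∑ l, ∑ m, (Lᵀ * L) l m * ∑ i : Fin (n l), ∑ j : Fin (n m),
      spin (x l i) * spin (x m j) = ∑ i, (L *ᵥ magnetisation n x) i ^ 2 := by
    have h1 : ∀ l m, ∑ i : Fin (n l), ∑ j : Fin (n m), spin (x l i) * spin (x m j) =
        magnetisation n x l * magnetisation n x m := fun l m => by
      simp only [magnetisation, Finset.sum_mul_sum]
    simp_rw [h1]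
    have h2 : ∑ i, (L *ᵥ magnetisation n x) i ^ 2 =
        magnetisation n x ⬝ᵥ (Lᵀ * L) *ᵥ magnetisation n x := by
      rw [← mulVec_mulVec, dotProduct_mulVec, vecMul_transpose]
      simp [dotProduct, sq]
    rw [h2]
    simp only [dotProduct, mulVec, Finset.mul_sum]
    exact Finset.sum_congr rfl fun l _ => Finset.sum_congr rfl fun m _ => by ring
  rw [hamiltonian, h]
  simp_rw [div_pow, Real.sq_sqrt (Nat.cast_nonneg (total n))]
  rw [← Finset.sum_div]
  ring

/-- The complex field acting on the spins of group `l` in the Hubbard–Stratonovich representation. -/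
noncomputable def field (L : Matrix κ (Fin M) ℝ) (n : Fin M → ℕ) (t : Fin M → ℝ) (g : κ → ℝ)
    (l : Fin M) : ℂ :=
  (((Lᵀ *ᵥ g) l / √(total n : ℝ) : ℝ) : ℂ) + ((t l / √(n l : ℝ) : ℝ) : ℂ) * Complex.I

theorem sum_exp_field_mul_magnetisation (n : Fin M → ℕ) (w : Fin M → ℂ) :
    ∑ x : Config n, Complex.exp (∑ l, w l * (magnetisation n x l : ℂ)) =
      ∏ l, (2 * Complex.cosh (w l)) ^ n l := by
  have h1 : ∀ x : Config n, Complex.exp (∑ l, w l * (magnetisation n x l : ℂ)) =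
      ∏ l, ∏ i : Fin (n l), Complex.exp (w l * (spin (x l i) : ℂ)) := fun x => by
    simp_rw [← Complex.exp_sum, magnetisation, Complex.ofReal_sum, Finset.mul_sum]
  have h2 : ∀ l, (2 * Complex.cosh (w l)) ^ n l =
      ∑ y : Fin (n l) → ℤˣ, ∏ i, Complex.exp (w l * (spin (y i) : ℂ)) := fun l => by
    rw [← Fintype.prod_sum (fun (_ : Fin (n l)) (s : ℤˣ) => Complex.exp (w l * (spin s : ℂ)))]
    have : ∑ s : ℤˣ, Complex.exp (w l * (spin s : ℂ)) = 2 * Complex.cosh (w l) := by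
      rw [Complex.two_cosh, show (Finset.univ : Finset ℤˣ) = {1, -1} by decide,
        Finset.sum_pair (by decide)]
      simp [spin]
    simp only [this, Finset.prod_const, Finset.card_univ, Fintype.card_fin]
  simp_rw [h1, h2]
  rw [Fintype.prod_sum]

/-- The prefactor on the left is the standard Gaussian integral. Each spin, once summed out,
contributes `2 cosh` of its group's field. -/
theorem charNumerator_eq_integral (L : Matrix κ (Fin M) ℝ) (n : Fin M → ℕ) (t : Fin M → ℝ) :
    (Real.pi / (1 / 2 : ℂ)) ^ (Fintype.card κ / 2 : ℂ) * charNumerator (Lᵀ * L) n t =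
      2 ^ total n * ∫ g : κ → ℝ, Complex.exp (-((g ⬝ᵥ g : ℝ) : ℂ) / 2) *
        ∏ l, Complex.cosh (field L n t g l) ^ n l := by
  set u : Config n → κ → ℝ := fun x i => (L *ᵥ magnetisation n x) i / √(total n : ℝ) with hu
  set θ : Config n → ℝ := fun x => ∑ l, t l * (magnetisation n x l / √(n l : ℝ)) with hθ
  have hint : ∀ x : Config n, Integrable fun g : κ → ℝ =>
      Complex.exp (-(1 / 2 : ℂ) * ∑ i, (g i : ℂ) ^ 2 + ∑ i, (u x i : ℂ) * g i) *
        Complex.exp (θ x * Complex.I) := fun x =>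
    (GaussianFourier.integrable_cexp_neg_mul_sum_add (by norm_num) _).mul_const _
  have hsum : ∀ g : κ → ℝ, 2 ^ total n * (Complex.exp (-((g ⬝ᵥ g : ℝ) : ℂ) / 2) *
        ∏ l, Complex.cosh (field L n t g l) ^ n l) = ∑ x : Config n,
      Complex.exp (-(1 / 2 : ℂ) * ∑ i, (g i : ℂ) ^ 2 + ∑ i, (u x i : ℂ) * g i) *
        Complex.exp (θ x * Complex.I) := fun g => by
    have hp : (2 : ℂ) ^ total n * ∏ l, Complex.cosh (field L n t g l) ^ n l =
        ∏ l, (2 * Complex.cosh (field L n t g l)) ^ n l := by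
      simp_rw [mul_pow, Finset.prod_mul_distrib, Finset.prod_pow_eq_pow_sum, total]
    rw [mul_left_comm, hp, ← sum_exp_field_mul_magnetisation, Finset.mul_sum]
    refine Finset.sum_congr rfl fun x _ => ?_
    rw [← Complex.exp_add, ← Complex.exp_add, add_assoc]
    congr 2
    · simp only [dotProduct]
      push_cast
      rw [Finset.mul_sum, ← Finset.sum_neg_distrib, Finset.sum_div]
      exact Finset.sum_congr rfl fun i _ => by ring
    · have h1 : ∑ i, u x i * g i = ∑ l, (Lᵀ *ᵥ g) l / √(total n : ℝ) * magnetisation n x l := by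
        have : (L *ᵥ magnetisation n x) ⬝ᵥ g = (Lᵀ *ᵥ g) ⬝ᵥ magnetisation n x := by
          rw [dotProduct_comm, dotProduct_mulVec, mulVec_transpose]
        have h2 := congrArg (fun r => r / √(total n : ℝ)) this
        simp only [dotProduct, Finset.sum_div] at h2
        calc _ = _ := Finset.sum_congr rfl fun i _ => by rw [hu]; ring
          _ = _ := h2
          _ = _ := Finset.sum_congr rfl fun i _ => by ring
      have h3 : ∑ i, (u x i : ℂ) * g i = ((∑ i, u x i * g i : ℝ) : ℂ) := by push_cast; rfl
      rw [h3, h1, hθ]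
      simp only [field]
      push_cast
      rw [Finset.sum_mul, ← Finset.sum_add_distrib]
      exact Finset.sum_congr rfl fun i _ => by ring
  rw [← integral_const_mul]
  simp_rw [hsum]
  rw [integral_finsetSum _ fun x _ => hint x, charNumerator, Finset.mul_sum]
  refine Finset.sum_congr rfl fun x _ => ?_
  rw [integral_mul_const, GaussianFourier.integral_cexp_neg_mul_sum_add (by norm_num), mul_assoc,
    ← Complex.exp_add, neg_hamiltonian_transpose_mul_self]
  congr 3
  push_cast
  norm_num [hu]

theorem tendsto_integral_prod_cosh_field [DecidableEq κ] (L : Matrix κ (Fin M) ℝ) {n : ℕ → Fin M → ℕ}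
    {α : Fin M → ℝ} (hn : ∀ l, Tendsto (fun k => n k l) atTop atTop)
    (hα : ∀ l, Tendsto (fun k => (n k l : ℝ) / (total (n k) : ℝ)) atTop (𝓝 (α l)))
    (hK : (1 - L * diagonal α * Lᵀ).PosDef) (t : Fin M → ℝ) :
    Tendsto (fun k => ∫ g : κ → ℝ, Complex.exp (-((g ⬝ᵥ g : ℝ) : ℂ) / 2) *
        ∏ l, Complex.cosh (field L (n k) t g l) ^ n k l) atTop
      (𝓝 (∫ g : κ → ℝ, Complex.exp (-((g ⬝ᵥ g : ℝ) : ℂ) / 2) *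
        ∏ l, Complex.exp
          ((((√(α l) * (Lᵀ *ᵥ g) l : ℝ) : ℂ) + (t l : ℂ) * Complex.I) ^ 2 / 2))) := by
  obtain ⟨ε, hε, hle⟩ := exists_eventually_quadratic_le L hα hK
  refine tendsto_integral_filter_of_dominated_convergence
    (fun g => Real.exp (-(ε / 2) * (g ⬝ᵥ g))) ?_ ?_ ?_ ?_
  · refine Eventually.of_forall fun k => Continuous.aestronglyMeasurable ?_
    simp only [field, dotProduct, mulVec]
    fun_prop
  · filter_upwards [hle] with k hk
    refine Eventually.of_forall fun g => ?_
    -- Only the real part of the field enters the bound, so the dominating function does not depend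
    -- on `t`.
    have h1 : ∀ l, ‖Complex.cosh (field L (n k) t g l) ^ n k l‖ ≤
        Real.exp ((n k l : ℝ) / (total (n k) : ℝ) * (Lᵀ *ᵥ g) l ^ 2 / 2) := fun l => by
      rw [norm_pow]
      refine (pow_le_pow_left₀ (norm_nonneg _) (norm_cosh_le_exp _) _).trans_eq ?_
      rw [← Real.exp_nat_mul]
      congr 1
      have : (field L (n k) t g l).re = (Lᵀ *ᵥ g) l / √(total (n k) : ℝ) := by
        simp [field]
      rw [this, div_pow, Real.sq_sqrt (Nat.cast_nonneg _)]
      ring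
    rw [norm_mul, norm_prod, Complex.norm_exp]
    refine (mul_le_mul_of_nonneg_left
      (Finset.prod_le_prod (fun l _ => norm_nonneg _) fun l _ => h1 l) (Real.exp_nonneg _)).trans ?_
    rw [← Real.exp_sum, ← Real.exp_add, Real.exp_le_exp, ← Finset.sum_div]
    have h2 : (-((g ⬝ᵥ g : ℝ) : ℂ) / 2).re = -(g ⬝ᵥ g) / 2 := by
      rw [← Complex.ofReal_neg, ← Complex.ofReal_ofNat, ← Complex.ofReal_div, Complex.ofReal_re]
    have := hk g
    rw [h2]
    linarith
  · have h := (GaussianFourier.integrable_cexp_neg_mul_sum_add (ι := κ) (b := ((ε / 2 : ℝ) : ℂ))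
      (by rw [Complex.ofReal_re]; positivity) 0).norm
    refine h.congr (Eventually.of_forall fun g => ?_)
    have h2 : -((ε / 2 : ℝ) : ℂ) * ∑ i, (g i : ℂ) ^ 2 + ∑ i, (0 : κ → ℂ) i * g i =
        ((-(ε / 2) * (g ⬝ᵥ g) : ℝ) : ℂ) := by
      simp [dotProduct, sq]
    simp only [h2]
    rw [Complex.norm_exp, Complex.ofReal_re]
  · refine Eventually.of_forall fun g => Tendsto.const_mul _ (tendsto_finsetProd _ fun l _ => ?_)
    refine tendsto_cosh_pow (hn l) ?_
    have h1 : Tendsto (fun k => ((√((n k l : ℝ) / (total (n k) : ℝ)) * (Lᵀ *ᵥ g) l : ℝ) : ℂ) +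
        (t l : ℂ) * Complex.I) atTop
        (𝓝 (((√(α l) * (Lᵀ *ᵥ g) l : ℝ) : ℂ) + (t l : ℂ) * Complex.I)) :=
      ((Complex.continuous_ofReal.tendsto _).comp
        (((Real.continuous_sqrt.tendsto _).comp (hα l)).mul_const _)).add_const _
    refine h1.congr' ?_
    filter_upwards [(hn l).eventually_gt_atTop 0] with k hk
    have hs : √(n k l : ℝ) ≠ 0 := (Real.sqrt_pos.2 (Nat.cast_pos.2 hk)).ne'
    rw [field, mul_add, ← mul_assoc, ← Complex.ofReal_mul, ← Complex.ofReal_mul,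
      mul_div_cancel₀ _ hs, Real.sqrt_div (Nat.cast_nonneg _)]
    congr 2
    ring

end

/-! ### Evaluation of the limit and the two cases. -/

section

variable {M : ℕ} {κ : Type*} [Fintype κ]

theorem limitCovariance_transpose_mul_mul (α : Fin M → ℝ) (L : Matrix κ (Fin M) ℝ)
    (S : Matrix κ κ ℝ) :
    limitCovariance α (Lᵀ * S * L) =
      1 + (L * diagonal fun l => √(α l))ᵀ * S * (L * diagonal fun l => √(α l)) := by
  simp only [limitCovariance, transpose_mul, diagonal_transpose, Matrix.mul_assoc]

theorem posSemidef_limitCovariance (α : Fin M → ℝ) (L : Matrix κ (Fin M) ℝ) {S : Matrix κ κ ℝ}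
    (hS : S.PosSemidef) : (limitCovariance α (Lᵀ * S * L)).PosSemidef := by
  rw [limitCovariance_transpose_mul_mul]
  refine PosSemidef.one.add ?_
  simpa only [conjTranspose_eq_transpose_of_trivial] using
    hS.conjTranspose_mul_mul_same (L * diagonal fun l => √(α l))

theorem dotProduct_limitCovariance (α : Fin M → ℝ) (L : Matrix κ (Fin M) ℝ) (S : Matrix κ κ ℝ)
    (t : Fin M → ℝ) :
    t ⬝ᵥ limitCovariance α (Lᵀ * S * L) *ᵥ t =
      t ⬝ᵥ t + (L *ᵥ fun l => √(α l) * t l) ⬝ᵥ S *ᵥ (L *ᵥ fun l => √(α l) * t l) := by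
  have h : (L * diagonal fun l => √(α l)) *ᵥ t = L *ᵥ fun l => √(α l) * t l := by
    rw [← mulVec_mulVec]
    congr 1
    ext l
    rw [mulVec_diagonal]
  rw [limitCovariance_transpose_mul_mul, add_mulVec, one_mulVec, dotProduct_add, ← mulVec_mulVec,
    ← mulVec_mulVec, h, dotProduct_mulVec t, vecMul_transpose, h]

variable [DecidableEq κ]

/-- Expanding the squares, the terms quadratic in `g` turn `|g|²` into the form of `K`, the cross
terms give the Fourier variable `L √α t`, and the rest is `exp (-|t|²/2)`, the source of the
identity in `C`. -/
theorem exists_integral_prod_exp_field (L : Matrix κ (Fin M) ℝ) {α : Fin M → ℝ}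
    (hα : ∀ l, 0 ≤ α l) (hK : (1 - L * diagonal α * Lᵀ).PosDef) :
    ∃ c : ℂ, c ≠ 0 ∧ ∀ t : Fin M → ℝ,
      ∫ g : κ → ℝ, Complex.exp (-((g ⬝ᵥ g : ℝ) : ℂ) / 2) *
        ∏ l, Complex.exp
          ((((√(α l) * (Lᵀ *ᵥ g) l : ℝ) : ℂ) + (t l : ℂ) * Complex.I) ^ 2 / 2) =
      c * Complex.exp (-((t ⬝ᵥ limitCovariance α (Lᵀ * (1 - L * diagonal α * Lᵀ)⁻¹ * L) *ᵥ t : ℝ) :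
        ℂ) / 2) := by
  obtain ⟨c, hc, hint⟩ := exists_integral_cexp_neg_quadratic hK
  refine ⟨c, hc, fun t => ?_⟩
  have hpt : ∀ g : κ → ℝ, Complex.exp (-((g ⬝ᵥ g : ℝ) : ℂ) / 2) *
      ∏ l, Complex.exp
        ((((√(α l) * (Lᵀ *ᵥ g) l : ℝ) : ℂ) + (t l : ℂ) * Complex.I) ^ 2 / 2) =
      Complex.exp (-((t ⬝ᵥ t : ℝ) : ℂ) / 2) *
        Complex.exp (-((g ⬝ᵥ (1 - L * diagonal α * Lᵀ) *ᵥ g : ℝ) : ℂ) / 2 +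
          (((L *ᵥ fun l => √(α l) * t l) ⬝ᵥ g : ℝ) : ℂ) * Complex.I) := fun g => by
    have h1 : (L *ᵥ fun l => √(α l) * t l) ⬝ᵥ g = ∑ l, √(α l) * t l * (Lᵀ *ᵥ g) l := by
      rw [dotProduct_comm, dotProduct_mulVec, ← mulVec_transpose, dotProduct_comm]
      rfl
    have h2 : ∀ l, ((((√(α l) * (Lᵀ *ᵥ g) l : ℝ) : ℂ) + (t l : ℂ) * Complex.I) ^ 2 / 2) =
        ((α l * (Lᵀ *ᵥ g) l ^ 2 : ℝ) : ℂ) / 2 - ((t l * t l : ℝ) : ℂ) / 2 +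
          ((√(α l) * t l * (Lᵀ *ᵥ g) l : ℝ) : ℂ) * Complex.I := fun l => by
      have hs : ((√(α l) : ℝ) : ℂ) ^ 2 = α l := by
        rw [← Complex.ofReal_pow, Real.sq_sqrt (hα l)]
      push_cast
      rw [← hs]
      linear_combination (t l : ℂ) ^ 2 / 2 * Complex.I_sq
    rw [← Complex.exp_sum, ← Complex.exp_add, ← Complex.exp_add,
      dotProduct_one_sub_mul_diagonal_mul_transpose, h1]
    simp_rw [h2]
    rw [Finset.sum_add_distrib, Finset.sum_sub_distrib, ← Finset.sum_div, ← Finset.sum_div,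
      ← Finset.sum_mul, dotProduct_comm t t, dotProduct]
    simp only [dotProduct, Complex.ofReal_sub, Complex.ofReal_sum]
    congr 1
    ring
  simp_rw [hpt]
  rw [integral_const_mul, hint, dotProduct_limitCovariance, mul_left_comm, ← Complex.exp_add]
  congr 2
  push_cast
  ring

theorem convergesToGaussian_transpose_mul_self (L : Matrix κ (Fin M) ℝ) {n : ℕ → Fin M → ℕ}
    {α : Fin M → ℝ} (hn : ∀ l, Tendsto (fun k => n k l) atTop atTop)
    (hα : ∀ l, Tendsto (fun k => (n k l : ℝ) / (total (n k) : ℝ)) atTop (𝓝 (α l)))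
    (hK : (1 - L * diagonal α * Lᵀ).PosDef) :
    ConvergesToGaussian (Lᵀ * L) n
      (limitCovariance α (Lᵀ * (1 - L * diagonal α * Lᵀ)⁻¹ * L)) := by
  have hα0 : ∀ l, 0 ≤ α l := fun l => ge_of_tendsto' (hα l) fun k => by positivity
  have hC := posSemidef_limitCovariance α L hK.inv.posSemidef
  obtain ⟨c, hc, hint⟩ := exists_integral_prod_exp_field L hα0 hK
  refine ⟨hC, ⟨fun k => (measurable_of_finite _).aemeasurable, by fun_prop, ?_⟩⟩
  refine ProbabilityMeasure.tendsto_iff_tendsto_charFun.2 fun t => ?_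
  have hratio : ∀ k, charFun ((canonicalEnsemble (Lᵀ * L) (n k)).map
      (normalisedMagnetisation (n k))) t =
      (∫ g : κ → ℝ, Complex.exp (-((g ⬝ᵥ g : ℝ) : ℂ) / 2) *
        ∏ l, Complex.cosh (field L (n k) t g l) ^ n k l) /
      ∫ g : κ → ℝ, Complex.exp (-((g ⬝ᵥ g : ℝ) : ℂ) / 2) *
        ∏ l, Complex.cosh (field L (n k) 0 g l) ^ n k l := fun k => by
    have hpi : (Real.pi / (1 / 2 : ℂ)) ^ (Fintype.card κ / 2 : ℂ) ≠ 0 := by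
      rw [Complex.cpow_def_of_ne_zero (by simp [Real.pi_ne_zero])]
      exact Complex.exp_ne_zero _
    rw [charFun_normalisedMagnetisation, ← mul_div_mul_left _ _ hpi, charNumerator_eq_integral,
      charNumerator_eq_integral, mul_div_mul_left _ _ (pow_ne_zero _ two_ne_zero)]
  have h1 := tendsto_integral_prod_cosh_field L hn hα hK t
  have h0 := tendsto_integral_prod_cosh_field L hn hα hK 0
  rw [hint] at h1 h0
  have hlim := h1.div h0 (mul_ne_zero hc (Complex.exp_ne_zero _))
  simp only [ProbabilityMeasure.coe_mk, Measure.map_id, hratio]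
  rw [charFun_multivariateGaussian hC]
  convert! hlim using 2
  rw [mul_div_mul_left _ _ hc]
  simp [neg_div]

theorem constMatrix_eq_transpose_mul_self (M : ℕ) {β : ℝ} (hβ : 0 ≤ β) :
    constMatrix M β = (Matrix.of fun (_ : Fin 1) (_ : Fin M) => √β)ᵀ *
      Matrix.of fun (_ : Fin 1) (_ : Fin M) => √β := by
  ext l m
  simp [constMatrix, Matrix.mul_apply, Real.mul_self_sqrt hβ]

theorem sum_eq_one_of_tendsto (hM : 0 < M) {n : ℕ → Fin M → ℕ} {α : Fin M → ℝ}
    (hn : ∀ l, Tendsto (fun k => n k l) atTop atTop)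
    (hα : ∀ l, Tendsto (fun k => (n k l : ℝ) / (total (n k) : ℝ)) atTop (𝓝 (α l))) :
    ∑ l, α l = 1 := by
  refine tendsto_nhds_unique (tendsto_finsetSum Finset.univ fun l _ => hα l)
    (tendsto_const_nhds.congr' ?_)
  filter_upwards [(hn ⟨0, hM⟩).eventually_gt_atTop 0] with k hk
  have hpos : 0 < total (n k) :=
    hk.trans_le (Finset.single_le_sum (f := n k) (fun _ _ => Nat.zero_le _) (Finset.mem_univ _))
  rw [← Finset.sum_div, ← Nat.cast_sum]
  exact (div_self (Nat.cast_ne_zero.2 hpos.ne')).symm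

theorem convergesToGaussian_constMatrix {n : ℕ → Fin M → ℕ} {α : Fin M → ℝ}
    (hn : ∀ l, Tendsto (fun k => n k l) atTop atTop)
    (hα : ∀ l, Tendsto (fun k => (n k l : ℝ) / (total (n k) : ℝ)) atTop (𝓝 (α l)))
    (hsum : ∑ l, α l = 1) {β : ℝ} (hβ : 0 ≤ β) (hβ1 : β < 1) :
    ConvergesToGaussian (constMatrix M β) n
      (limitCovariance α (constMatrix M (β / (1 - β)))) := by
  set L : Matrix (Fin 1) (Fin M) ℝ := Matrix.of fun _ _ => √β with hL
  -- The auxiliary field is one-dimensional, and `∑ l, α l = 1` makes `K` the scalar `1 - β`.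
  have hK : 1 - L * diagonal α * Lᵀ = diagonal fun _ => 1 - β := by
    ext i j
    have : ∑ l, √β * α l * √β = β := by
      have h : ∀ l, √β * α l * √β = β * α l := fun l => by
        rw [mul_right_comm, Real.mul_self_sqrt hβ]
      simp_rw [h]
      rw [← Finset.mul_sum, hsum, mul_one]
    have hij : (L * diagonal α * Lᵀ) i j = β := by
      rw [Matrix.mul_apply]
      simp_rw [mul_diagonal]
      exact this
    rw [Subsingleton.elim j i] at hij ⊢
    rw [Matrix.sub_apply, hij, one_apply_eq, diagonal_apply_eq]
  have hpos : (1 - L * diagonal α * Lᵀ).PosDef := by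
    rw [hK]
    exact PosDef.diagonal fun _ => sub_pos.2 hβ1
  have hS : constMatrix M (β / (1 - β)) = Lᵀ * (1 - L * diagonal α * Lᵀ)⁻¹ * L := by
    have hinv : (1 - L * diagonal α * Lᵀ)⁻¹ = diagonal fun _ => (1 - β)⁻¹ := by
      rw [hK]
      refine inv_eq_right_inv ?_
      rw [diagonal_mul_diagonal, ← diagonal_one]
      congr 1
      ext
      exact mul_inv_cancel₀ (sub_pos.2 hβ1).ne'
    rw [hinv]
    ext l m
    simp [constMatrix, hL, Matrix.mul_apply, mul_right_comm _ _ √β, Real.mul_self_sqrt hβ,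
      div_eq_mul_inv]
  rw [hS, constMatrix_eq_transpose_mul_self M hβ]
  exact convergesToGaussian_transpose_mul_self L hn hα hpos

theorem convergesToGaussian_of_posDef_hessian {n : ℕ → Fin M → ℕ} {α : Fin M → ℝ}
    (hn : ∀ l, Tendsto (fun k => n k l) atTop atTop)
    (hα : ∀ l, Tendsto (fun k => (n k l : ℝ) / (total (n k) : ℝ)) atTop (𝓝 (α l)))
    {J : Matrix (Fin M) (Fin M) ℝ} (hJ : J.PosDef) (hH : (hessian J α).PosDef) :
    ConvergesToGaussian J n (limitCovariance α (hessian J α)⁻¹) := by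
  obtain ⟨L, rfl⟩ := exists_transpose_mul_self hJ.posSemidef
  have hunit : IsUnit L.det := by
    have h := hJ.det_pos
    rw [det_mul, det_transpose] at h
    exact isUnit_iff_ne_zero.2 fun h0 => by simp [h0] at h
  have hunit' : IsUnit Lᵀ.det := by rwa [det_transpose]
  -- `K` is congruent to `H`, so it inherits positive definiteness, and `Lᵀ K⁻¹ L = H⁻¹`.
  have hK : 1 - L * diagonal α * Lᵀ = L * hessian (Lᵀ * L) α * Lᵀ := by
    rw [hessian, Matrix.mul_inv_rev, Matrix.mul_sub, Matrix.sub_mul, ← Matrix.mul_assoc,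
      mul_nonsing_inv _ hunit, Matrix.one_mul, nonsing_inv_mul _ hunit']
  have hpos : (1 - L * diagonal α * Lᵀ).PosDef := by
    rw [hK]
    have := hH.mul_mul_conjTranspose_same (B := L)
      (vecMul_injective_iff_isUnit.2 ((isUnit_iff_isUnit_det _).2 hunit))
    rwa [conjTranspose_eq_transpose_of_trivial] at this
  have hS : (hessian (Lᵀ * L) α)⁻¹ = Lᵀ * (1 - L * diagonal α * Lᵀ)⁻¹ * L := by
    rw [hK, Matrix.mul_inv_rev, Matrix.mul_inv_rev, ← Matrix.mul_assoc, ← Matrix.mul_assoc,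
      mul_nonsing_inv _ hunit', Matrix.one_mul, Matrix.mul_assoc, nonsing_inv_mul _ hunit,
      Matrix.mul_one]
  rw [hS]
  exact convergesToGaussian_transpose_mul_self L hn hα hpos

end

end

end CurieWeiss

theorem mainTheorem1 {M : ℕ} (hM : 0 < M) (n : ℕ → Fin M → ℕ) (α : Fin M → ℝ)
    (hn : ∀ l, Tendsto (fun k => n k l) atTop atTop)
    (hα : ∀ l, Tendsto (fun k => (n k l : ℝ) / (CurieWeiss.total (n k) : ℝ)) atTop (𝓝 (α l))) :
    (∀ β : ℝ, 0 ≤ β → β < 1 →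
      CurieWeiss.ConvergesToGaussian (CurieWeiss.constMatrix M β) n
        (CurieWeiss.limitCovariance α (CurieWeiss.constMatrix M (β / (1 - β))))) ∧
    (∀ J : Matrix (Fin M) (Fin M) ℝ, J.PosDef → (CurieWeiss.hessian J α).PosDef →
      CurieWeiss.ConvergesToGaussian J n
        (CurieWeiss.limitCovariance α (CurieWeiss.hessian J α)⁻¹)) := by
  have hsum := CurieWeiss.sum_eq_one_of_tendsto hM hn hα
  exact ⟨fun _ hβ hβ1 => CurieWeiss.convergesToGaussian_constMatrix hn hα hsum hβ hβ1,
    fun _ hJ hH => CurieWeiss.convergesToGaussian_of_posDef_hessian hn hα hJ hH⟩
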